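/- Let $B_n$ denote the Bernoulli numbers and $\zeta$ the Riemann zeta function. For an integer $k\ge 2$ define the polynomials $$P_k(z)=\frac{(2\pi)^{2k-1}}{(2k)!}\sum_{j=0}^{k}(-1)^jB_{2j}B_{2k-2j}\binom{2k}{2j}z^{2j}+\zeta(2k-1)\left(z^{2k-1}+(-1)^kz\right),$$ $$Q_k(z)=(2^{2k}+1)P_k(z)-2^{2k}P_k(z/2)-P_k(2z).$$ Then for every $k\ge 2$, $$Q_k(z)=\frac{(2\pi)^{2k-1}}{(2k)!}\sum_{j=0}^{k}(-1)^jB_{2j}B_{2k-2j}(2^{2j}-1)(2^{2k-2j}-1)\binom{2k}{2j}z^{2j}+\zeta(2k-1)(2^{2k-1}-1)\left((-1)^kz+z^{2k-1}\right),$$ every non-zero complex root of $Q_k$ lies on the unit circle $|z|=1$, and all complex roots of $Q_k$ (including $z=0$) are simple. -/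

import Mathlib

open Polynomial

/-- The polynomial
`P_k(z) = (2π)^(2k-1)/(2k)! * ∑_{j=0}^k (-1)^j B_{2j} B_{2k-2j} C(2k,2j) z^(2j)
  + ζ(2k-1) (z^(2k-1) + (-1)^k z)`, for `k ≥ 2`. -/
noncomputable def polyP (k : ℕ) : ℂ[X] :=
  C ((2 * (Real.pi : ℂ)) ^ (2 * k - 1) / ((2 * k).factorial : ℂ)) *
      ∑ j ∈ Finset.range (k + 1),
        C ((-1) ^ j * (_root_.bernoulli (2 * j) : ℂ) * (_root_.bernoulli (2 * k - 2 * j) : ℂ) *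
          ((2 * k).choose (2 * j) : ℂ)) * X ^ (2 * j) +
    C (riemannZeta (2 * (k : ℂ) - 1)) * (X ^ (2 * k - 1) + C ((-1) ^ k) * X)

/-- The polynomial `Q_k(z) = (2^(2k) + 1) P_k(z) - 2^(2k) P_k(z/2) - P_k(2z)`. -/
noncomputable def polyQ (k : ℕ) : ℂ[X] :=
  C ((2 : ℂ) ^ (2 * k) + 1) * polyP k -
    C ((2 : ℂ) ^ (2 * k)) * (polyP k).comp (C (1 / 2 : ℂ) * X) -
    (polyP k).comp (C (2 : ℂ) * X)

/-! Write `k = N + 1`. In terms of the sums `oddZeta s` over odd integers, `Q_k` is a constant times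
`z * reducedQ N`, where `reducedQ N` has degree at most `2N` and does not vanish at `0`. It suffices
to exhibit `2N` distinct roots of `reducedQ N` on the unit circle: with `0` they exhaust the degree
of `Q_k`, which gives location and simplicity at once.

On the open right half of the circle, the products of even `oddZeta` values are double series.
Summing them as geometric series and using the partial fractions of tanh turns `reducedQ N` into an
expression in `λ = oddZeta (2N+1)` and `T = tanhSeries N` (`sum_oddZeta_eq_tanhSeries`). For a sign
`σ` and `z = exp (iθ)`, `|θ| < π/2`, put `G(θ) = λ - σ T(exp (-iθ))`. Then `reducedQ N (σ z) =
z^(2N) G(θ) + (-1)^(N+1) conj G(θ)`, which vanishes as soon as `Nθ + arg G(θ) = (N - 2j) π/2` for an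
integer `j`.

This phase is odd and continuous while `G` avoids the negative real axis, so the intermediate value
theorem counts roots. For `σ = -1`, `Re G > 0` and one gets `N - 1` roots in the left half plane.
For `σ = 1`, `Im T > 0` on the open quarter circle keeps `G` in the slit plane, while near `θ = π/2`
the bound `Re T ≥ 5/4 > λ` pushes `arg G` beyond `π/2`; this yields `N + 1` roots in the right half
plane. -/

/-! ### Explicit coefficients of `Q_k`. -/

theorem polyQ_eq (k : ℕ) (hk : 2 ≤ k) :
    polyQ k =
        C ((2 * (Real.pi : ℂ)) ^ (2 * k - 1) / ((2 * k).factorial : ℂ)) *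
            ∑ j ∈ Finset.range (k + 1),
              C ((-1) ^ j * (_root_.bernoulli (2 * j) : ℂ) * (_root_.bernoulli (2 * k - 2 * j) : ℂ) *
                ((2 : ℂ) ^ (2 * j) - 1) * ((2 : ℂ) ^ (2 * k - 2 * j) - 1) *
                ((2 * k).choose (2 * j) : ℂ)) * X ^ (2 * j) +
          C (riemannZeta (2 * (k : ℂ) - 1) * ((2 : ℂ) ^ (2 * k - 1) - 1)) *
            (C ((-1) ^ k) * X + X ^ (2 * k - 1)) := by
  apply Polynomial.funext
  intro z
  simp only [polyQ, polyP, eval_add, eval_sub, eval_mul, eval_C, eval_comp, eval_finsetSum,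
    eval_pow, eval_X]
  have hsum : ((2 : ℂ) ^ (2 * k) + 1) * (∑ j ∈ Finset.range (k + 1),
        ((-1) ^ j * (_root_.bernoulli (2 * j) : ℂ) * (_root_.bernoulli (2 * k - 2 * j) : ℂ) *
          ((2 * k).choose (2 * j) : ℂ)) * z ^ (2 * j)) -
      (2 : ℂ) ^ (2 * k) * (∑ j ∈ Finset.range (k + 1),
        ((-1) ^ j * (_root_.bernoulli (2 * j) : ℂ) * (_root_.bernoulli (2 * k - 2 * j) : ℂ) *
          ((2 * k).choose (2 * j) : ℂ)) * (1 / 2 * z) ^ (2 * j)) -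
      (∑ j ∈ Finset.range (k + 1),
        ((-1) ^ j * (_root_.bernoulli (2 * j) : ℂ) * (_root_.bernoulli (2 * k - 2 * j) : ℂ) *
          ((2 * k).choose (2 * j) : ℂ)) * (2 * z) ^ (2 * j)) =
      ∑ j ∈ Finset.range (k + 1),
        ((-1) ^ j * (_root_.bernoulli (2 * j) : ℂ) * (_root_.bernoulli (2 * k - 2 * j) : ℂ) *
          ((2 : ℂ) ^ (2 * j) - 1) * ((2 : ℂ) ^ (2 * k - 2 * j) - 1) *
          ((2 * k).choose (2 * j) : ℂ)) * z ^ (2 * j) := by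
    rw [Finset.mul_sum, Finset.mul_sum, ← Finset.sum_sub_distrib, ← Finset.sum_sub_distrib]
    refine Finset.sum_congr rfl fun j hj => ?_
    have hjk : 2 * k = (2 * k - 2 * j) + 2 * j := by
      have := Finset.mem_range.1 hj
      omega
    have h2 : (2 : ℂ) ^ (2 * k) = 2 ^ (2 * k - 2 * j) * 2 ^ (2 * j) := by
      rw [← pow_add, ← hjk]
    have h3 : (2 : ℂ) ^ (2 * j) * (1 / 2) ^ (2 * j) = 1 := by
      rw [← mul_pow]
      norm_num
    rw [h2, mul_pow, mul_pow]
    generalize (2 : ℂ) ^ (2 * k - 2 * j) = a at *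
    generalize (2 : ℂ) ^ (2 * j) = b at *
    generalize (1 / 2 : ℂ) ^ (2 * j) = c at *
    -- With `a = 2^(2k-2j)` and `b = 2^(2j)` the coefficient is `ab + 1 - a - b = (a - 1)(b - 1)`.
    linear_combination (-((-1) ^ j * (_root_.bernoulli (2 * j) : ℂ) *
      (_root_.bernoulli (2 * k - 2 * j) : ℂ) * ((2 * k).choose (2 * j) : ℂ)) * a * z ^ (2 * j)) * h3
  have h2 : (2 : ℂ) ^ (2 * k) = 2 * 2 ^ (2 * k - 1) := by
    rw [← pow_succ']
    congr 1
    omega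
  have h3 : (2 : ℂ) ^ (2 * k - 1) * (1 / 2) ^ (2 * k - 1) = 1 := by
    rw [← mul_pow]
    norm_num
  rw [← hsum, mul_pow (1 / 2) z (2 * k - 1), mul_pow 2 z (2 * k - 1), h2]
  generalize (2 : ℂ) ^ (2 * k - 1) = a at *
  generalize (1 / 2 : ℂ) ^ (2 * k - 1) = b at *
  linear_combination (-2 * riemannZeta (2 * k - 1) * z ^ (2 * k - 1)) * h3

/-! ### Zeta sums over odd integers and the reduced polynomial. -/

/-- The sum of `n ^ (-s)` over the odd positive integers `n`. -/
noncomputable def oddZeta (s : ℕ) : ℝ := ∑' m : ℕ, 1 / (2 * (m : ℝ) + 1) ^ s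

theorem summable_odd_pow {s : ℕ} (hs : 2 ≤ s) :
    Summable fun m : ℕ => 1 / (2 * (m : ℝ) + 1) ^ s := by
  have h := (Real.summable_one_div_nat_pow (p := s)).2 (by omega)
  have := h.comp_injective (i := fun m : ℕ => 2 * m + 1) (fun a b hab => by simpa using hab)
  refine this.congr fun m => ?_
  simp

theorem oddZeta_eq {s : ℕ} (hs : 2 ≤ s) :
    oddZeta s = (1 - 1 / 2 ^ s) * ∑' n : ℕ, 1 / (n : ℝ) ^ s := by
  have h := (Real.summable_one_div_nat_pow (p := s)).2 (by omega)
  have he : (fun m : ℕ => 1 / ((2 * m : ℕ) : ℝ) ^ s) = fun m : ℕ => 1 / 2 ^ s * (1 / (m : ℝ) ^ s) := by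
    funext m
    push_cast
    rw [mul_pow, one_div_mul_one_div]
  have ho : (fun m : ℕ => 1 / ((2 * m + 1 : ℕ) : ℝ) ^ s) = fun m : ℕ => 1 / (2 * (m : ℝ) + 1) ^ s := by
    funext m
    push_cast
    rfl
  have := tsum_even_add_odd (f := fun n : ℕ => 1 / (n : ℝ) ^ s)
    (by rw [he]; exact h.mul_left _) (by rw [ho]; exact summable_odd_pow hs)
  rw [he, ho, tsum_mul_left] at this
  rw [oddZeta]
  linear_combination this

theorem one_le_oddZeta {s : ℕ} (hs : 2 ≤ s) : 1 ≤ oddZeta s := by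
  have := (summable_odd_pow hs).le_tsum 0 (fun m _ => by positivity)
  simpa [oddZeta] using this

theorem oddZeta_le_oddZeta_two {s : ℕ} (hs : 2 ≤ s) : oddZeta s ≤ oddZeta 2 := by
  refine (summable_odd_pow hs).tsum_le_tsum (fun m => ?_) (summable_odd_pow le_rfl)
  have : (1 : ℝ) ≤ 2 * m + 1 := by
    have : (0 : ℝ) ≤ m := m.cast_nonneg
    linarith
  gcongr

/-- The value is `π²/8`. The margin below `5/4` is what both estimates on the tanh series rest on.
-/
theorem oddZeta_two_lt : oddZeta 2 < 5 / 4 := by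
  rw [oddZeta_eq le_rfl, hasSum_zeta_two.tsum_eq]
  have h1 := Real.pi_lt_d2
  have h2 := Real.pi_pos
  nlinarith

theorem oddZeta_even {j : ℕ} (hj : j ≠ 0) :
    (oddZeta (2 * j) : ℂ) = (1 - 1 / 2 ^ (2 * j)) * ((-1) ^ (j + 1) * 2 ^ (2 * j - 1) *
      (Real.pi : ℂ) ^ (2 * j) * (_root_.bernoulli (2 * j) : ℂ) / ((2 * j).factorial : ℂ)) := by
  rw [oddZeta_eq (by omega), (hasSum_zeta_nat hj).tsum_eq]
  push_cast
  rfl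

theorem oddZeta_eq_riemannZeta {s : ℕ} (hs : 2 ≤ s) :
    (oddZeta s : ℂ) = (1 - 1 / 2 ^ s) * riemannZeta s := by
  rw [oddZeta_eq hs, zeta_nat_eq_tsum_of_gt_one (by omega)]
  push_cast
  rfl

/-- The polynomial `Q_{N+1}(z) / (2 ^ (2N+1) z)`. -/
noncomputable def reducedQ (N : ℕ) : ℂ[X] :=
  C (oddZeta (2 * N + 1) : ℂ) * (C ((-1) ^ (N + 1)) + X ^ (2 * N)) +
    C (4 / (Real.pi : ℂ)) * ∑ i ∈ Finset.range N,
      C ((-1) ^ (N + i) * (oddZeta (2 * (i + 1)) : ℂ) * (oddZeta (2 * (N - i)) : ℂ)) *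
        X ^ (2 * i + 1)

theorem polyQ_eq_reducedQ {N : ℕ} (hN : 1 ≤ N) :
    polyQ (N + 1) = C (2 ^ (2 * N + 1)) * X * reducedQ N := by
  rw [polyQ_eq _ (by omega)]
  apply Polynomial.funext
  intro z
  simp only [reducedQ, eval_add, eval_mul, eval_C, eval_finsetSum, eval_pow, eval_X]
  -- The terms `j = 0` and `j = k` are split off because their factor `2^0 - 1` kills them.
  rw [Finset.sum_range_succ, Finset.sum_range_succ']
  have e1 : 2 * (N + 1) - 1 = 2 * N + 1 := by omega
  have e2 : (2 * ((N + 1 : ℕ) : ℂ) - 1) = ((2 * N + 1 : ℕ) : ℂ) := by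
    push_cast
    ring
  rw [e1, e2, oddZeta_eq_riemannZeta (by omega)]
  have hp : (Real.pi : ℂ) ≠ 0 := by exact_mod_cast Real.pi_ne_zero
  have hsum : (2 * (Real.pi : ℂ)) ^ (2 * N + 1) / ((2 * (N + 1)).factorial : ℂ) *
      (∑ j ∈ Finset.range N, (-1) ^ (j + 1) * (_root_.bernoulli (2 * (j + 1)) : ℂ) *
        (_root_.bernoulli (2 * (N + 1) - 2 * (j + 1)) : ℂ) * ((2 : ℂ) ^ (2 * (j + 1)) - 1) *
        ((2 : ℂ) ^ (2 * (N + 1) - 2 * (j + 1)) - 1) *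
          ((2 * (N + 1)).choose (2 * (j + 1)) : ℂ) * z ^ (2 * (j + 1))) =
      2 ^ (2 * N + 1) * z * (4 / (Real.pi : ℂ) * ∑ i ∈ Finset.range N,
        (-1) ^ (N + i) * (oddZeta (2 * (i + 1)) : ℂ) * (oddZeta (2 * (N - i)) : ℂ) *
          z ^ (2 * i + 1)) := by
    rw [Finset.mul_sum, Finset.mul_sum, Finset.mul_sum]
    refine Finset.sum_congr rfl fun j hj => ?_
    obtain ⟨m, rfl⟩ : ∃ m, N = j + (m + 1) :=
      ⟨N - j - 1, by have := Finset.mem_range.1 hj; omega⟩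
    rw [oddZeta_even (by omega), oddZeta_even (by omega)]
    have e3 : 2 * (j + (m + 1) + 1) - 2 * (j + 1) = 2 * (m + 1) := by omega
    have e4 : j + (m + 1) - j = m + 1 := by omega
    have e5 : 2 * (j + 1) - 1 = 2 * j + 1 := by omega
    have e6 : 2 * (m + 1) - 1 = 2 * m + 1 := by omega
    rw [e3, e4, e5, e6, Nat.cast_choose ℂ (by omega : 2 * (j + 1) ≤ 2 * (j + (m + 1) + 1)), e3]
    have f1 : ((2 * (j + 1)).factorial : ℂ) ≠ 0 := by exact_mod_cast Nat.factorial_ne_zero _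
    have f2 : ((2 * (m + 1)).factorial : ℂ) ≠ 0 := by exact_mod_cast Nat.factorial_ne_zero _
    have f3 : ((2 * (j + (m + 1) + 1)).factorial : ℂ) ≠ 0 := by
      exact_mod_cast Nat.factorial_ne_zero _
    have hs : ((-1 : ℂ)) ^ (j + (m + 1) + j) * (-1) ^ (j + 1 + 1) * (-1) ^ (m + 1 + 1) =
        (-1) ^ (j + 1) := by
      rw [← pow_add, ← pow_add, show j + (m + 1) + j + (j + 1 + 1) + (m + 1 + 1) =
        2 * (j + m + 2) + (j + 1) by ring, pow_add, pow_mul]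
      simp
    have g1 : (2 : ℂ) ^ (2 * (j + 1)) = 2 * 2 ^ (2 * j + 1) := by ring
    have g2 : (2 : ℂ) ^ (2 * (m + 1)) = 2 * 2 ^ (2 * m + 1) := by ring
    have g5 : (Real.pi : ℂ) ^ (2 * (j + 1)) * Real.pi ^ (2 * (m + 1)) =
        Real.pi * Real.pi ^ (2 * (j + (m + 1)) + 1) := by ring
    have g6 : z ^ (2 * (j + 1)) = z * z ^ (2 * j + 1) := by ring
    rw [g1, g2, g6, mul_pow, ← hs]
    field_simp
    linear_combination (-4 * (_root_.bernoulli (2 * (j + 1)) : ℂ) *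
      (_root_.bernoulli (2 * (m + 1)) : ℂ) * (2 * 2 ^ (2 * j + 1) - 1) *
      (2 * 2 ^ (2 * m + 1) - 1) * z * z ^ (2 * j + 1)) * g5
  have h2 : (2 : ℂ) ^ (2 * N + 1) ≠ 0 := pow_ne_zero _ two_ne_zero
  simp only [mul_zero, pow_zero, sub_self, tsub_self, zero_mul, mul_one, add_zero]
  rw [hsum]
  field_simp
  ring

theorem reducedQ_eval_zero_ne_zero {N : ℕ} (hN : 1 ≤ N) : (reducedQ N).eval 0 ≠ 0 := by
  have h : (oddZeta (2 * N + 1) : ℂ) ≠ 0 := by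
    have := one_le_oddZeta (s := 2 * N + 1) (by omega)
    exact_mod_cast (by linarith : (0 : ℝ) < oddZeta (2 * N + 1)).ne'
  simp [reducedQ, eval_finsetSum, h, zero_pow (by omega : 2 * N ≠ 0)]

theorem natDegree_reducedQ_le (N : ℕ) : (reducedQ N).natDegree ≤ 2 * N := by
  unfold reducedQ
  refine natDegree_add_le_of_degree_le ?_ ?_
  · compute_degree
  · refine (natDegree_C_mul_le _ _).trans (natDegree_sum_le_of_forall_le _ _ fun i hi => ?_)
    have := Finset.mem_range.1 hi
    compute_degree
    omega

/-! ### Partial fractions of tanh and the double series. -/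

/-- From `tan t = cot t - 2 cot 2t` and the cotangent series at `x = iy` and `x/2`: the even
integers cancel and the odd ones remain. -/
theorem tanh_pi_mul_div_two {y : ℂ} (hy : 0 < y.re) :
    Complex.tanh (Real.pi * y / 2) =
      4 * y / Real.pi * ∑' m : ℕ, 1 / ((2 * (m : ℂ) + 1) ^ 2 + y ^ 2) := by
  have hcompl : ∀ c : ℝ, 0 < c → y * Complex.I * c ∈ Complex.integerComplement := by
    rintro c hc ⟨n, hn⟩
    have := congrArg Complex.im hn
    simp at this
    rcases this with h | h <;> linarith
  set x : ℂ := y * Complex.I with hx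
  have h1 : x ∈ Complex.integerComplement := by simpa using hcompl 1 one_pos
  have h2 : x / 2 ∈ Complex.integerComplement := by
    have := hcompl (1 / 2) (by norm_num)
    push_cast at this
    rwa [mul_one_div] at this
  have c1 := cot_series_rep' h1
  have c2 := cot_series_rep' h2
  have s1 := summable_cotTerm h1
  -- The series is indexed from `0` with poles at `± (n + 1)`, so even indices carry the odd
  -- integers.
  have hev : (fun m : ℕ => (1 / (x - (((2 * m : ℕ) : ℂ) + 1)) + 1 / (x + (((2 * m : ℕ) : ℂ) + 1)))) =
      fun m : ℕ => -2 * x * (1 / ((2 * (m : ℂ) + 1) ^ 2 + y ^ 2)) := by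
    funext m
    have hm1 : x - (2 * (m : ℂ) + 1) ≠ 0 := fun h => h1 ⟨2 * m + 1, by
      push_cast
      linear_combination -h⟩
    have hm2 : x + (2 * (m : ℂ) + 1) ≠ 0 := fun h => h1 ⟨-(2 * m + 1), by
      push_cast
      linear_combination -h⟩
    have hm3 : (2 * (m : ℂ) + 1) ^ 2 + y ^ 2 = -((x - (2 * (m : ℂ) + 1)) * (x + (2 * (m : ℂ) + 1))) := by
      rw [hx]
      linear_combination (y ^ 2) * Complex.I_sq
    push_cast
    rw [hm3]
    field_simp
    ring
  have hod : (fun m : ℕ => (1 / (x - (((2 * m + 1 : ℕ) : ℂ) + 1)) +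
        1 / (x + (((2 * m + 1 : ℕ) : ℂ) + 1)))) =
      fun m : ℕ => 1 / 2 * (1 / (x / 2 - ((m : ℂ) + 1)) + 1 / (x / 2 + ((m : ℂ) + 1))) := by
    funext m
    push_cast
    rw [show x - (2 * (m : ℂ) + 1 + 1) = 2 * (x / 2 - (m + 1)) by ring,
      show x + (2 * (m : ℂ) + 1 + 1) = 2 * (x / 2 + (m + 1)) by ring]
    simp only [one_div, mul_inv]
    ring
  have hsplit := tsum_even_add_odd
    (f := fun n : ℕ => 1 / (x - ((n : ℂ) + 1)) + 1 / (x + ((n : ℂ) + 1)))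
    (s1.comp_injective (i := fun m : ℕ => 2 * m) fun a b hab => by simpa using hab)
    (s1.comp_injective (i := fun m : ℕ => 2 * m + 1) fun a b hab => by simpa using hab)
  simp only [hev, hod] at hsplit
  rw [tsum_mul_left, tsum_mul_left, ← c1, ← c2] at hsplit
  have hs : Complex.sin (Real.pi * (x / 2)) ≠ 0 := sin_pi_mul_ne_zero h2
  have hs2 : Complex.sin (Real.pi * x) ≠ 0 := sin_pi_mul_ne_zero h1
  have hdouble : (Real.pi : ℂ) * x = 2 * (Real.pi * (x / 2)) := by ring
  have hc : Complex.cos (Real.pi * (x / 2)) ≠ 0 := by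
    rw [hdouble, Complex.sin_two_mul] at hs2
    exact right_ne_zero_of_mul hs2
  have htan : Complex.tan (Real.pi * (x / 2)) =
      Complex.cot (Real.pi * (x / 2)) - 2 * Complex.cot (Real.pi * x) := by
    rw [hdouble, Complex.tan_eq_sin_div_cos, Complex.cot, Complex.cot, Complex.sin_two_mul,
      Complex.cos_two_mul']
    generalize Real.pi * (x / 2) = t at *
    field_simp
    ring
  have htanh : Complex.tan (Real.pi * (x / 2)) = Complex.tanh (Real.pi * y / 2) * Complex.I := by
    rw [← Complex.tan_mul_I, hx]
    congr 1
    ring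
  have hp : (Real.pi : ℂ) ≠ 0 := by exact_mod_cast Real.pi_ne_zero
  rw [htanh] at htan
  set S := ∑' m : ℕ, 1 / ((2 * (m : ℂ) + 1) ^ 2 + y ^ 2)
  have hxx : 1 / 2 * (1 / (x / 2)) = 1 / x := by
    field_simp
  have key : Real.pi * (Complex.tanh (Real.pi * y / 2) * Complex.I) = 4 * x * S := by
    linear_combination (Real.pi : ℂ) * htan + 2 * hsplit + 2 * hxx
  have : Real.pi * Complex.tanh (Real.pi * y / 2) = 4 * y * S := by
    apply mul_right_cancel₀ Complex.I_ne_zero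
    rw [hx] at key
    linear_combination key
  field_simp
  linear_combination this

/-- The right side is a geometric sum of ratio `-(z a / b)²`. Its two ends, the `1` and the `q^N` in
`1 - q^N`, give the two terms on the left, exchanged by `a ↔ b`, `z ↔ z⁻¹`. -/
theorem geometric_identity (N : ℕ) {a b z : ℂ} (ha : a ≠ 0) (hb : b ≠ 0) (hz : z ≠ 0)
    (hD : b ^ 2 + a ^ 2 * z ^ 2 ≠ 0) :
    (-1) ^ (N + 1) * z * (1 / (a ^ (2 * N) * (b ^ 2 + a ^ 2 * z ^ 2))) +
        z ^ (2 * N) * z⁻¹ * (1 / (b ^ (2 * N) * (a ^ 2 + b ^ 2 * z⁻¹ ^ 2))) =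
      -∑ i ∈ Finset.range N, (-1) ^ (N + i) * z ^ (2 * i + 1) *
        (1 / b ^ (2 * (i + 1)) * (1 / a ^ (2 * (N - i)))) := by
  set q : ℂ := -(z ^ 2 * a ^ 2 / b ^ 2) with hq
  have hq1 : 1 - q = (b ^ 2 + a ^ 2 * z ^ 2) / b ^ 2 := by
    rw [hq]
    field_simp
    ring
  have hterm : ∀ i ∈ Finset.range N, (-1) ^ (N + i) * z ^ (2 * i + 1) *
        (1 / b ^ (2 * (i + 1)) * (1 / a ^ (2 * (N - i)))) =
      (-1) ^ N * z / (a ^ (2 * N) * b ^ 2) * q ^ i := by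
    intro i hi
    obtain ⟨m, rfl⟩ : ∃ m, N = i + m := ⟨N - i, by have := Finset.mem_range.1 hi; omega⟩
    rw [Nat.add_sub_cancel_left, hq, neg_pow (z ^ 2 * a ^ 2 / b ^ 2), div_pow, mul_pow]
    field_simp
    ring
  rw [Finset.sum_congr rfl hterm, ← Finset.mul_sum]
  have hgeom := mul_neg_geom_sum q N
  have hqN : q ^ N = (-1) ^ N * (z ^ (2 * N) * a ^ (2 * N) / b ^ (2 * N)) := by
    rw [hq, neg_pow, div_pow, mul_pow]
    simp only [pow_mul]
  have hS : ∑ i ∈ Finset.range N, q ^ i = (1 - q ^ N) * b ^ 2 / (b ^ 2 + a ^ 2 * z ^ 2) := by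
    rw [eq_div_iff hD, ← hgeom, hq1]
    field_simp
  have hD2 : a ^ 2 + b ^ 2 * z⁻¹ ^ 2 = (b ^ 2 + a ^ 2 * z ^ 2) / z ^ 2 := by
    field_simp
    ring
  have hsq : ((-1 : ℂ) ^ N) ^ 2 = 1 := by
    rw [← pow_mul, mul_comm, pow_mul]
    simp
  rw [hS, hqN, hD2]
  generalize hE : b ^ 2 + a ^ 2 * z ^ 2 = E at *
  rw [pow_succ]
  generalize (-1 : ℂ) ^ N = e at *
  field_simp
  linear_combination (-z ^ (2 * N) * a ^ (2 * N)) * hsq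

/-- `∑ tanh (π n z / 2) / n ^ (2N+1)` over the odd positive integers `n`. -/
noncomputable def tanhSeries (N : ℕ) (z : ℂ) : ℂ :=
  ∑' m : ℕ, Complex.tanh (Real.pi * ((2 * (m : ℂ) + 1) * z) / 2) / (2 * (m : ℂ) + 1) ^ (2 * N + 1)

theorem odd_ne_zero (m : ℕ) : (2 * (m : ℂ) + 1) ≠ 0 := by
  exact_mod_cast Nat.succ_ne_zero (2 * m)

/-- Multiplying by `conj z`, of modulus one, gives `b² conj z + a² z`, whose real part is `(a² + b²)
Re z`. This keeps the denominators of the double series away from zero. -/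
theorem re_mul_le_norm_sq_add {z : ℂ} (hz : ‖z‖ = 1) (a b : ℝ) (hre : 0 ≤ z.re) :
    b ^ 2 * z.re ≤ ‖(b : ℂ) ^ 2 + (a : ℂ) ^ 2 * z ^ 2‖ := by
  have h1 : (starRingEnd ℂ) z * z = 1 := by
    rw [← Complex.normSq_eq_conj_mul_self, Complex.normSq_eq_norm_sq, hz]
    simp
  have h2 : ‖(b : ℂ) ^ 2 + (a : ℂ) ^ 2 * z ^ 2‖ =
      ‖((b ^ 2 : ℝ) : ℂ) * (starRingEnd ℂ) z + ((a ^ 2 : ℝ) : ℂ) * z‖ := by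
    have : ((b ^ 2 : ℝ) : ℂ) * (starRingEnd ℂ) z + ((a ^ 2 : ℝ) : ℂ) * z =
        (starRingEnd ℂ) z * ((b : ℂ) ^ 2 + (a : ℂ) ^ 2 * z ^ 2) := by
      push_cast
      linear_combination (-(a : ℂ) ^ 2 * z) * h1
    rw [this, norm_mul, Complex.norm_conj, hz, one_mul]
  rw [h2]
  refine le_trans ?_ (Complex.re_le_norm _)
  rw [Complex.add_re, Complex.re_ofReal_mul, Complex.re_ofReal_mul, Complex.conj_re]
  have := mul_nonneg (sq_nonneg a) hre
  linarith

theorem sq_add_ne_zero {z : ℂ} (hz : ‖z‖ = 1) (hre : 0 < z.re) (m n : ℕ) :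
    (2 * (n : ℂ) + 1) ^ 2 + (2 * (m : ℂ) + 1) ^ 2 * z ^ 2 ≠ 0 := by
  have h := re_mul_le_norm_sq_add hz (2 * m + 1) (2 * n + 1) hre.le
  push_cast at h
  rw [← norm_pos_iff]
  exact lt_of_lt_of_le (by positivity) h

theorem summable_double {N : ℕ} (hN : 1 ≤ N) {z : ℂ} (hz : ‖z‖ = 1) (hre : 0 < z.re) :
    Summable fun p : ℕ × ℕ => 1 / ((2 * (p.1 : ℂ) + 1) ^ (2 * N) *
      ((2 * (p.2 : ℂ) + 1) ^ 2 + (2 * (p.1 : ℂ) + 1) ^ 2 * z ^ 2)) := by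
  have h := ((summable_odd_pow (s := 2 * N) (by omega)).mul_of_nonneg (summable_odd_pow le_rfl)
    (fun m => by positivity) (fun m => by positivity)).mul_right (z.re)⁻¹
  refine Summable.of_norm_bounded h fun p => ?_
  have hb := re_mul_le_norm_sq_add hz (2 * p.1 + 1) (2 * p.2 + 1) hre.le
  push_cast at hb
  have ho : ‖(2 * (p.1 : ℂ) + 1)‖ = 2 * (p.1 : ℝ) + 1 := by
    have : (2 * (p.1 : ℂ) + 1) = ((2 * p.1 + 1 : ℝ) : ℂ) := by push_cast; rfl
    rw [this, Complex.norm_real, Real.norm_of_nonneg (by positivity)]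
  rw [norm_div, norm_one, norm_mul, norm_pow, ho, one_div_mul_one_div, ← one_div,
    one_div_mul_one_div, mul_assoc]
  apply one_div_le_one_div_of_le
  · positivity
  · gcongr

theorem tanhSeries_eq_tsum {N : ℕ} (hN : 1 ≤ N) {z : ℂ} (hz : ‖z‖ = 1) (hre : 0 < z.re) :
    tanhSeries N z = 4 / Real.pi * (z * ∑' p : ℕ × ℕ, 1 / ((2 * (p.1 : ℂ) + 1) ^ (2 * N) *
      ((2 * (p.2 : ℂ) + 1) ^ 2 + (2 * (p.1 : ℂ) + 1) ^ 2 * z ^ 2))) := by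
  rw [(summable_double hN hz hre).tsum_prod, ← tsum_mul_left, ← tsum_mul_left, tanhSeries]
  refine tsum_congr fun m => ?_
  have hm := odd_ne_zero m
  rw [tanh_pi_mul_div_two, ← tsum_mul_left, ← tsum_mul_left, ← tsum_mul_left, ← tsum_div_const]
  · refine tsum_congr fun n => ?_
    have hD := sq_add_ne_zero hz hre m n
    have hp : (Real.pi : ℂ) ≠ 0 := by exact_mod_cast Real.pi_ne_zero
    rw [mul_pow]
    generalize (2 * (n : ℂ) + 1) ^ 2 + (2 * (m : ℂ) + 1) ^ 2 * z ^ 2 = D at *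
    generalize 2 * (m : ℂ) + 1 = a at *
    field_simp
    ring
  · have : (2 * (m : ℂ) + 1) = ((2 * m + 1 : ℝ) : ℂ) := by push_cast; rfl
    rw [this, Complex.re_ofReal_mul]
    positivity

theorem ofReal_oddZeta (s : ℕ) : (oddZeta s : ℂ) = ∑' m : ℕ, 1 / (2 * (m : ℂ) + 1) ^ s := by
  rw [oddZeta, Complex.ofReal_tsum]
  push_cast
  rfl

theorem summable_norm_odd_pow {s : ℕ} (hs : 2 ≤ s) :
    Summable fun m : ℕ => ‖1 / (2 * (m : ℂ) + 1) ^ s‖ := by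
  refine (summable_odd_pow hs).congr fun m => ?_
  have : (2 * (m : ℂ) + 1) = ((2 * m + 1 : ℝ) : ℂ) := by push_cast; rfl
  rw [this, norm_div, norm_one, norm_pow, Complex.norm_real, Real.norm_of_nonneg (by positivity)]

/-- Both sides are sums over pairs of odd integers `(a, b)`, and `geometric_identity` matches them
pair by pair. The swap of coordinates puts the `z⁻¹` series in the right order. -/
theorem sum_oddZeta_eq_tanhSeries {N : ℕ} (hN : 1 ≤ N) {z : ℂ} (hz : ‖z‖ = 1) (hre : 0 < z.re) :
    4 / (Real.pi : ℂ) * ∑ i ∈ Finset.range N,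
      (-1) ^ (N + i) * (oddZeta (2 * (i + 1)) : ℂ) * (oddZeta (2 * (N - i)) : ℂ) *
        z ^ (2 * i + 1) =
    -((-1) ^ (N + 1) * tanhSeries N z + z ^ (2 * N) * tanhSeries N z⁻¹) := by
  have hz0 : z ≠ 0 := by
    rintro rfl
    simp at hre
  have hzi : ‖z⁻¹‖ = 1 := by rw [norm_inv, hz, inv_one]
  have hrei : 0 < z⁻¹.re := by
    rw [Complex.inv_re]
    exact div_pos hre (Complex.normSq_pos.2 hz0)
  have s1 := summable_double hN hz hre
  have s2 := (Equiv.prodComm ℕ ℕ).summable_iff.2 (summable_double hN hzi hrei)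
  have hprod : ∀ i ∈ Finset.range N, (-1) ^ (N + i) * (oddZeta (2 * (i + 1)) : ℂ) *
      (oddZeta (2 * (N - i)) : ℂ) * z ^ (2 * i + 1) = ∑' p : ℕ × ℕ, (-1) ^ (N + i) * z ^ (2 * i + 1) *
        (1 / (2 * (p.2 : ℂ) + 1) ^ (2 * (i + 1)) * (1 / (2 * (p.1 : ℂ) + 1) ^ (2 * (N - i)))) := by
    intro i hi
    have := Finset.mem_range.1 hi
    rw [tsum_mul_left, ← (Equiv.prodComm ℕ ℕ).tsum_eq]
    simp only [Equiv.prodComm_apply, Prod.fst_swap, Prod.snd_swap]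
    rw [← tsum_mul_tsum_of_summable_norm (summable_norm_odd_pow (by omega))
      (summable_norm_odd_pow (by omega)), ← ofReal_oddZeta, ← ofReal_oddZeta]
    ring
  have hsummable : ∀ i ∈ Finset.range N, Summable fun p : ℕ × ℕ => (-1) ^ (N + i) * z ^ (2 * i + 1) *
        (1 / (2 * (p.2 : ℂ) + 1) ^ (2 * (i + 1)) * (1 / (2 * (p.1 : ℂ) + 1) ^ (2 * (N - i)))) := by
    intro i hi
    have := Finset.mem_range.1 hi
    refine Summable.mul_left _ ?_
    exact (Equiv.prodComm ℕ ℕ).summable_iff.2 (summable_mul_of_summable_norm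
      (summable_norm_odd_pow (s := 2 * (i + 1)) (by omega))
      (summable_norm_odd_pow (s := 2 * (N - i)) (by omega)))
  rw [Finset.sum_congr rfl hprod, ← Summable.tsum_finsetSum hsummable,
    tanhSeries_eq_tsum hN hz hre, tanhSeries_eq_tsum hN hzi hrei,
    ← (Equiv.prodComm ℕ ℕ).tsum_eq (fun p : ℕ × ℕ => 1 / ((2 * (p.1 : ℂ) + 1) ^ (2 * N) *
      ((2 * (p.2 : ℂ) + 1) ^ 2 + (2 * (p.1 : ℂ) + 1) ^ 2 * z⁻¹ ^ 2)))]
  have hgeom := fun p : ℕ × ℕ => geometric_identity N (odd_ne_zero p.1) (odd_ne_zero p.2) hz0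
    (sq_add_ne_zero hz hre p.1 p.2)
  have hadd := (s1.mul_left ((-1) ^ (N + 1) * z)).tsum_add (s2.mul_left (z ^ (2 * N) * z⁻¹))
  rw [tsum_mul_left, tsum_mul_left] at hadd
  simp only [Function.comp_def, Equiv.prodComm_apply, Prod.fst_swap, Prod.snd_swap] at hadd ⊢
  rw [tsum_congr hgeom, tsum_neg] at hadd
  linear_combination (-4 / (Real.pi : ℂ)) * hadd

/-! ### Real and imaginary parts of tanh; convergence and continuity of the tanh series. -/

theorem tanh_eq_one_sub {w : ℂ} (h : 1 + Complex.exp (2 * w) ≠ 0) :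
    Complex.tanh w = 1 - 2 / (1 + Complex.exp (2 * w)) := by
  have hx := Complex.exp_ne_zero w
  rw [two_mul, Complex.exp_add] at h ⊢
  rw [Complex.tanh_eq_sinh_div_cosh, Complex.sinh, Complex.cosh, Complex.exp_neg]
  generalize Complex.exp w = x at *
  have h' : x + x⁻¹ = (1 + x * x) / x := by
    field_simp
    ring
  have h'' : x - x⁻¹ = (x * x - 1) / x := by
    field_simp
  rw [h', h'', div_div_div_cancel_right₀ (two_ne_zero' ℂ), div_div_div_cancel_right₀ hx,
    eq_sub_iff_add_eq, ← add_div, div_eq_one_iff_eq h]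
  ring

theorem norm_exp_sub_one_le (w : ℂ) :
    Real.exp (2 * w.re) - 1 ≤ ‖1 + Complex.exp (2 * w)‖ := by
  have h := norm_sub_le (1 + Complex.exp (2 * w)) 1
  rw [add_sub_cancel_left, norm_one, Complex.norm_exp] at h
  simp only [Complex.mul_re, Complex.re_ofNat, Complex.im_ofNat, zero_mul, sub_zero] at h
  linarith

theorem one_add_exp_ne_zero {w : ℂ} (h : 0 < w.re) : 1 + Complex.exp (2 * w) ≠ 0 := by
  rw [← norm_pos_iff]
  have := Real.one_lt_exp_iff.2 (by linarith : 0 < 2 * w.re)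
  linarith [norm_exp_sub_one_le w]

theorem norm_tanh_le {w : ℂ} {c : ℝ} (hc : 0 < c) (h : c ≤ w.re) :
    ‖Complex.tanh w‖ ≤ 1 + 2 / (Real.exp (2 * c) - 1) := by
  rw [tanh_eq_one_sub (one_add_exp_ne_zero (hc.trans_le h))]
  refine (norm_sub_le _ _).trans ?_
  rw [norm_one, norm_div, Complex.norm_ofNat]
  have h1 := Real.one_lt_exp_iff.2 (by linarith : 0 < 2 * c)
  have h2 := Real.exp_le_exp.2 (by linarith : 2 * c ≤ 2 * w.re)
  have h3 := norm_exp_sub_one_le w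
  have : 0 < Real.exp (2 * c) - 1 := by linarith
  gcongr
  linarith

theorem tanh_re {w : ℂ} (h : 0 < w.re) : (Complex.tanh w).re =
    (Complex.normSq (Complex.exp (2 * w)) - 1) / Complex.normSq (1 + Complex.exp (2 * w)) := by
  have h0 := one_add_exp_ne_zero h
  have h1 : Complex.normSq (1 + Complex.exp (2 * w)) ≠ 0 := (Complex.normSq_pos.2 h0).ne'
  rw [tanh_eq_one_sub h0, Complex.sub_re, Complex.div_re]
  simp only [Complex.one_re, Complex.re_ofNat, Complex.im_ofNat, zero_mul, zero_div, add_zero,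
    Complex.add_re]
  rw [eq_div_iff h1]
  have : Complex.normSq (1 + Complex.exp (2 * w)) = (1 + (Complex.exp (2 * w)).re) ^ 2 +
      (Complex.exp (2 * w)).im ^ 2 := by
    rw [Complex.normSq_apply]
    simp
    ring
  rw [sub_mul, div_mul_cancel₀ _ h1, this, Complex.normSq_apply]
  ring

theorem tanh_im {w : ℂ} (h : 0 < w.re) : (Complex.tanh w).im =
    2 * (Complex.exp (2 * w)).im / Complex.normSq (1 + Complex.exp (2 * w)) := by
  rw [tanh_eq_one_sub (one_add_exp_ne_zero h), Complex.sub_im, Complex.div_im]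
  simp

theorem tanh_re_pos {w : ℂ} (h : 0 < w.re) : 0 < (Complex.tanh w).re := by
  rw [tanh_re h]
  refine div_pos ?_ (Complex.normSq_pos.2 (one_add_exp_ne_zero h))
  rw [Complex.normSq_eq_norm_sq, Complex.norm_exp]
  have := Real.one_lt_exp_iff.2 (by simpa using h : 0 < (2 * w).re)
  nlinarith

theorem odd_mul_re (m : ℕ) (z : ℂ) :
    (Real.pi * ((2 * (m : ℂ) + 1) * z) / 2).re = Real.pi * (2 * m + 1) * z.re / 2 := by
  have : Real.pi * ((2 * (m : ℂ) + 1) * z) / 2 = ((Real.pi * (2 * m + 1) / 2 : ℝ) : ℂ) * z := by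
    push_cast
    ring
  rw [this, Complex.re_ofReal_mul]
  ring

theorem le_odd_mul_re (m : ℕ) {z : ℂ} {c : ℝ} (hc : 0 < c) (h : c ≤ z.re) :
    Real.pi * c / 2 ≤ (Real.pi * ((2 * (m : ℂ) + 1) * z) / 2).re := by
  rw [odd_mul_re]
  have hm : (1 : ℝ) ≤ 2 * m + 1 := by
    have : (0 : ℝ) ≤ m := m.cast_nonneg
    linarith
  have hp := Real.pi_pos
  have h1 : Real.pi * 1 ≤ Real.pi * (2 * m + 1) := by gcongr
  have h2 : Real.pi * 1 * c ≤ Real.pi * (2 * m + 1) * z.re := by gcongr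
  linarith

theorem odd_mul_re_pos (m : ℕ) {z : ℂ} (h : 0 < z.re) :
    0 < (Real.pi * ((2 * (m : ℂ) + 1) * z) / 2).re :=
  lt_of_lt_of_le (by positivity) (le_odd_mul_re m h le_rfl)

theorem odd_pow_eq_ofReal (m s : ℕ) : (2 * (m : ℂ) + 1) ^ s = (((2 * m + 1) ^ s : ℝ) : ℂ) := by
  push_cast
  rfl

theorem norm_tanhSeries_term_le {N : ℕ} (m : ℕ) {z : ℂ} {c : ℝ} (hc : 0 < c) (h : c ≤ z.re) :
    ‖Complex.tanh (Real.pi * ((2 * (m : ℂ) + 1) * z) / 2) / (2 * (m : ℂ) + 1) ^ (2 * N + 1)‖ ≤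
      (1 + 2 / (Real.exp (2 * (Real.pi * c / 2)) - 1)) * (1 / (2 * (m : ℝ) + 1) ^ (2 * N + 1)) := by
  rw [odd_pow_eq_ofReal, norm_div, Complex.norm_real, Real.norm_of_nonneg (by positivity),
    div_eq_mul_one_div]
  have := norm_tanh_le (by positivity) (le_odd_mul_re m hc h)
  gcongr

theorem summable_tanhSeries {N : ℕ} (hN : 1 ≤ N) {z : ℂ} (h : 0 < z.re) :
    Summable fun m : ℕ =>
      Complex.tanh (Real.pi * ((2 * (m : ℂ) + 1) * z) / 2) / (2 * (m : ℂ) + 1) ^ (2 * N + 1) :=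
  Summable.of_norm_bounded ((summable_odd_pow (by omega)).mul_left _)
    fun m => norm_tanhSeries_term_le m h le_rfl

theorem continuousOn_tanhSeries {N : ℕ} (hN : 1 ≤ N) {c : ℝ} (hc : 0 < c) :
    ContinuousOn (tanhSeries N) {z | c ≤ z.re} := by
  refine continuousOn_tsum (fun m => ?_) ((summable_odd_pow (s := 2 * N + 1) (by omega)).mul_left
    (1 + 2 / (Real.exp (2 * (Real.pi * c / 2)) - 1))) fun m z hz => norm_tanhSeries_term_le m hc hz
  refine ContinuousOn.div_const ?_ _
  have : ContinuousOn (fun z : ℂ =>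
      1 - 2 / (1 + Complex.exp (2 * (Real.pi * ((2 * (m : ℂ) + 1) * z) / 2)))) {z | c ≤ z.re} := by
    refine continuousOn_const.sub (continuousOn_const.div (by fun_prop) fun z hz => ?_)
    exact one_add_exp_ne_zero (odd_mul_re_pos m (hc.trans_le hz))
  refine this.congr fun z hz => ?_
  exact tanh_eq_one_sub (one_add_exp_ne_zero (odd_mul_re_pos m (hc.trans_le hz)))

theorem tanhSeries_conj (N : ℕ) (z : ℂ) :
    tanhSeries N ((starRingEnd ℂ) z) = (starRingEnd ℂ) (tanhSeries N z) := by
  rw [tanhSeries, tanhSeries, Complex.conj_tsum]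
  refine tsum_congr fun m => ?_
  rw [map_div₀, ← Complex.tanh_conj]
  simp [map_ofNat]

theorem hasSum_tanhSeries_re {N : ℕ} (hN : 1 ≤ N) {z : ℂ} (h : 0 < z.re) :
    HasSum (fun m : ℕ => (Complex.tanh (Real.pi * ((2 * (m : ℂ) + 1) * z) / 2)).re *
      (1 / (2 * (m : ℝ) + 1) ^ (2 * N + 1))) (tanhSeries N z).re := by
  have := Complex.hasSum_re (summable_tanhSeries hN h).hasSum
  rw [← tanhSeries] at this
  simpa only [odd_pow_eq_ofReal, Complex.div_ofReal_re, div_eq_mul_one_div (Complex.re _)] using this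

theorem hasSum_tanhSeries_im {N : ℕ} (hN : 1 ≤ N) {z : ℂ} (h : 0 < z.re) :
    HasSum (fun m : ℕ => (Complex.tanh (Real.pi * ((2 * (m : ℂ) + 1) * z) / 2)).im *
      (1 / (2 * (m : ℝ) + 1) ^ (2 * N + 1))) (tanhSeries N z).im := by
  have := Complex.hasSum_im (summable_tanhSeries hN h).hasSum
  rw [← tanhSeries] at this
  simpa only [odd_pow_eq_ofReal, Complex.div_ofReal_im, div_eq_mul_one_div (Complex.im _)] using this

theorem tanhSeries_re_nonneg {N : ℕ} (hN : 1 ≤ N) {z : ℂ} (h : 0 < z.re) :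
    0 ≤ (tanhSeries N z).re :=
  (hasSum_tanhSeries_re hN h).nonneg fun m =>
    mul_nonneg (tanh_re_pos (odd_mul_re_pos m h)).le (by positivity)

theorem re_tanh_le_re_tanhSeries {N : ℕ} (hN : 1 ≤ N) {z : ℂ} (h : 0 < z.re) :
    (Complex.tanh (Real.pi * z / 2)).re ≤ (tanhSeries N z).re := by
  have := le_hasSum (hasSum_tanhSeries_re hN h) 0 fun m _ =>
    mul_nonneg (tanh_re_pos (odd_mul_re_pos m h)).le (by positivity)
  simpa using this

theorem tanh_ofReal_re_lt_one (x : ℝ) : (Complex.tanh (x : ℂ)).re < 1 := by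
  rw [← Complex.ofReal_tanh, Complex.ofReal_re]
  exact Real.tanh_lt_one x

theorem tanhSeries_one_re_lt {N : ℕ} (hN : 1 ≤ N) :
    (tanhSeries N 1).re < oddZeta (2 * N + 1) := by
  have hlt : ∀ m : ℕ, (Complex.tanh (Real.pi * ((2 * (m : ℂ) + 1) * 1) / 2)).re *
      (1 / (2 * (m : ℝ) + 1) ^ (2 * N + 1)) < 1 / (2 * (m : ℝ) + 1) ^ (2 * N + 1) := by
    intro m
    have h := tanh_ofReal_re_lt_one (Real.pi * ((2 * m + 1) * 1) / 2)
    push_cast at h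
    exact mul_lt_of_lt_one_left (by positivity) h
  exact hasSum_lt (fun m => (hlt m).le) (hlt 0) (hasSum_tanhSeries_re hN (by simp))
    (summable_odd_pow (by omega)).hasSum

/-! ### Estimates for the tanh series on the quarter circle. -/

theorem abs_sin_nat_mul_le (n : ℕ) (x : ℝ) : |Real.sin (n * x)| ≤ n * |Real.sin x| := by
  induction n with
  | zero => simp
  | succ n ih =>
    push_cast
    rw [add_mul, one_mul, Real.sin_add]
    refine (abs_add_le _ _).trans ?_
    rw [abs_mul, abs_mul, add_mul, one_mul]
    have h1 := Real.abs_cos_le_one x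
    have h2 := Real.abs_cos_le_one (n * x)
    have h3 := abs_nonneg (Real.sin x)
    have h4 := abs_nonneg (Real.sin (n * x))
    nlinarith

/-- This is the square of `x/2 ≤ sinh (x/2)`, since `exp x - 1 = 2 exp (x/2) sinh (x/2)`. -/
theorem sq_mul_exp_le (x : ℝ) (hx : 0 ≤ x) : Real.exp x * x ^ 2 ≤ (Real.exp x - 1) ^ 2 := by
  have h := Real.self_le_sinh_iff.2 (by linarith : 0 ≤ x / 2)
  rw [Real.sinh_eq, Real.exp_neg] at h
  have ht : Real.exp x = Real.exp (x / 2) ^ 2 := by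
    rw [← Real.exp_nat_mul]
    congr 1
    push_cast
    ring
  have hpos := Real.exp_pos (x / 2)
  rw [ht]
  generalize Real.exp (x / 2) = t at *
  have h1 : x * t ≤ t ^ 2 - 1 := by
    have : x ≤ t - t⁻¹ := by linarith
    calc x * t ≤ (t - t⁻¹) * t := by gcongr
      _ = t ^ 2 - 1 := by field_simp
  have h2 : 0 ≤ x * t := by positivity
  nlinarith

/-- The left side is `1 - cos (π (1 - sin θ))`, and `1 - sin θ ≤ 1 - sin² θ = cos² θ ≤ cos θ`. -/
theorem one_add_cos_pi_mul_sin_le {θ : ℝ} (h0 : 0 ≤ Real.sin θ) (h1 : 0 ≤ Real.cos θ) :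
    1 + Real.cos (Real.pi * Real.sin θ) ≤ (Real.pi * Real.cos θ) ^ 2 / 2 := by
  have h2 := Real.one_sub_sq_div_two_le_cos (x := Real.pi - Real.pi * Real.sin θ)
  rw [Real.cos_pi_sub] at h2
  have h3 := Real.sin_sq_add_cos_sq θ
  have h4 : 0 ≤ 1 - Real.sin θ := by linarith [Real.sin_le_one θ]
  have h5 : 1 - Real.sin θ ≤ Real.cos θ := by nlinarith [Real.cos_le_one θ]
  have hp := Real.pi_pos
  have h6 : (Real.pi - Real.pi * Real.sin θ) ^ 2 ≤ (Real.pi * Real.cos θ) ^ 2 := by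
    rw [show Real.pi - Real.pi * Real.sin θ = Real.pi * (1 - Real.sin θ) by ring]
    gcongr
  linarith

theorem two_mul_odd_mul_exp (m : ℕ) (θ : ℝ) :
    Complex.exp (2 * (Real.pi * ((2 * (m : ℂ) + 1) * Complex.exp (θ * Complex.I)) / 2)) =
      ((Real.exp (Real.pi * Real.cos θ) ^ (2 * m + 1) : ℝ) : ℂ) *
        Complex.exp (((2 * m + 1 : ℕ) * (Real.pi * Real.sin θ) : ℝ) * Complex.I) := by
  rw [← Real.exp_nat_mul, Complex.ofReal_exp, ← Complex.exp_add, Complex.exp_mul_I θ]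
  congr 1
  push_cast
  ring

/-- With `r = exp (π cos θ)` and `C = cos (π sin θ)`, the left side is `(r - 1)² + 2r(1 + C)`; the
two preceding bounds control the last term by `(r - 1)²`. The denominator of tanh is thus small near
`θ = π/2`. -/
theorem normSq_one_add_le {θ : ℝ} (h0 : 0 ≤ Real.sin θ) (h1 : 0 ≤ Real.cos θ) :
    Complex.normSq (1 + Complex.exp (2 * (Real.pi * Complex.exp (θ * Complex.I) / 2))) ≤
      4 * (Real.exp (Real.pi * Real.cos θ) - 1) ^ 2 := by
  have h := two_mul_odd_mul_exp 0 θ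
  simp only [Nat.cast_zero, mul_zero, zero_add, one_mul, pow_one, Nat.cast_one] at h
  rw [h, Complex.normSq_apply, Complex.add_re, Complex.add_im, Complex.re_ofReal_mul,
    Complex.im_ofReal_mul, Complex.exp_ofReal_mul_I_re, Complex.exp_ofReal_mul_I_im]
  have hc := one_add_cos_pi_mul_sin_le h0 h1
  have he := sq_mul_exp_le (Real.pi * Real.cos θ) (by positivity)
  have hr := Real.exp_pos (Real.pi * Real.cos θ)
  have hs := Real.sin_sq_add_cos_sq (Real.pi * Real.sin θ)
  simp only [Complex.one_re, Complex.one_im]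
  generalize Real.cos (Real.pi * Real.sin θ) = C at *
  generalize Real.sin (Real.pi * Real.sin θ) = S at *
  generalize Real.exp (Real.pi * Real.cos θ) = r at *
  have h2 : r * (1 + C) ≤ r * ((Real.pi * Real.cos θ) ^ 2 / 2) := by gcongr
  have h3 : r ^ 2 * S ^ 2 = r ^ 2 * (1 - C ^ 2) := by rw [← hs]; ring
  nlinarith [sq_nonneg (r - 1)]

/-- The first term alone suffices: its real part is at least `(r² - 1) / (4 (r - 1)²) = (r + 1) / (4
(r - 1))`, which equals `5/4` at `r = 3/2`. -/
theorem five_div_four_le_re_tanhSeries {N : ℕ} (hN : 1 ≤ N) {θ : ℝ} (h0 : 0 ≤ Real.sin θ)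
    (h1 : 0 < Real.cos θ) (h2 : Real.exp (Real.pi * Real.cos θ) ≤ 3 / 2) :
    5 / 4 ≤ (tanhSeries N (Complex.exp (θ * Complex.I))).re := by
  have hre : 0 < (Complex.exp (θ * Complex.I)).re := by rwa [Complex.exp_ofReal_mul_I_re]
  refine le_trans ?_ (re_tanh_le_re_tanhSeries hN hre)
  have hw := odd_mul_re_pos 0 hre
  simp only [Nat.cast_zero, mul_zero, zero_add, one_mul] at hw
  have hn := normSq_one_add_le h0 h1.le
  rw [tanh_re hw, le_div_iff₀ (Complex.normSq_pos.2 (one_add_exp_ne_zero hw)),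
    Complex.normSq_eq_norm_sq (Complex.exp _), Complex.norm_exp]
  have hr : (2 * (Real.pi * Complex.exp (θ * Complex.I) / 2)).re = Real.pi * Real.cos θ := by
    rw [mul_div_cancel₀ _ (two_ne_zero' ℂ), Complex.re_ofReal_mul, Complex.exp_ofReal_mul_I_re]
  rw [hr]
  have hr1 := Real.one_lt_exp_iff.2 (by positivity : 0 < Real.pi * Real.cos θ)
  generalize Real.exp (Real.pi * Real.cos θ) = r at *
  nlinarith

theorem pow_mul_sub_one_sq_le {r : ℝ} (hr : 1 < r) (n : ℕ) :
    r ^ (n + 1) * (r - 1) ^ 2 ≤ r * (r ^ (n + 1) - 1) ^ 2 := by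
  have h1 : 1 ≤ r ^ n := one_le_pow₀ hr.le
  have h2 : r ^ n * (r - 1) ≤ r ^ (n + 1) - 1 := by
    rw [pow_succ]
    linarith
  have h3 : (r ^ n * (r - 1)) ^ 2 ≤ (r ^ (n + 1) - 1) ^ 2 := by
    have : 0 ≤ r - 1 := by linarith
    gcongr
  have h4 : r ^ n * (r - 1) ^ 2 ≤ (r ^ n * (r - 1)) ^ 2 := by
    rw [mul_pow]
    have : r ^ n ≤ (r ^ n) ^ 2 := by nlinarith
    gcongr
  rw [pow_succ, mul_comm (r ^ n) r, mul_assoc]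
  have : 0 ≤ r := by linarith
  rw [mul_comm r (r ^ n), ← pow_succ]
  gcongr
  linarith

/-- The first term dominates: its imaginary part is at least `K`, while the term of the odd integer
`n` has tanh part at least `-4Kn`. The sum is at least `5K - 4K * oddZeta (2N)`, positive since
`oddZeta (2N) < 5/4`. -/
theorem tanhSeries_im_pos {N : ℕ} (hN : 1 ≤ N) {θ : ℝ} (h0 : 0 < θ) (h1 : θ < Real.pi / 2) :
    0 < (tanhSeries N (Complex.exp (θ * Complex.I))).im := by
  have hp := Real.pi_pos
  have hcos : 0 < Real.cos θ := Real.cos_pos_of_mem_Ioo ⟨by linarith, h1⟩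
  have hsin : 0 < Real.sin θ := Real.sin_pos_of_pos_of_lt_pi h0 (by linarith)
  have hsin1 : Real.sin θ < 1 := by
    nlinarith [Real.sin_sq_add_cos_sq θ]
  have hre : 0 < (Complex.exp (θ * Complex.I)).re := by rwa [Complex.exp_ofReal_mul_I_re]
  have hS : 0 < Real.sin (Real.pi * Real.sin θ) :=
    Real.sin_pos_of_pos_of_lt_pi (by positivity) (by nlinarith)
  have hr : 1 < Real.exp (Real.pi * Real.cos θ) := Real.one_lt_exp_iff.2 (by positivity)
  have hn := normSq_one_add_le hsin.le hcos.le
  set r := Real.exp (Real.pi * Real.cos θ) with hrdef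
  set S := Real.sin (Real.pi * Real.sin θ) with hSdef
  -- Lower bound for the first term: `2rS` over the bound `4(r - 1)²` of `normSq_one_add_le`.
  set K := r * S / (2 * (r - 1) ^ 2) with hK
  have hr1 : 0 < r - 1 := by linarith
  have hKpos : 0 < K := by positivity
  have him : ∀ m : ℕ, (Complex.exp (2 * (Real.pi * ((2 * (m : ℂ) + 1) *
      Complex.exp (θ * Complex.I)) / 2))).im =
        r ^ (2 * m + 1) * Real.sin ((2 * m + 1 : ℕ) * (Real.pi * Real.sin θ)) := by
    intro m
    rw [two_mul_odd_mul_exp, Complex.im_ofReal_mul, Complex.exp_ofReal_mul_I_im]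
  have hzero : K ≤ (Complex.tanh (Real.pi * ((2 * ((0 : ℕ) : ℂ) + 1) *
      Complex.exp (θ * Complex.I)) / 2)).im := by
    have hw := odd_mul_re_pos 0 hre
    rw [tanh_im hw, him, hK]
    have hpos := Complex.normSq_pos.2 (one_add_exp_ne_zero hw)
    simp only [Nat.cast_zero, mul_zero, zero_add, one_mul, pow_one, Nat.cast_one] at hpos ⊢
    rw [← hSdef, div_le_div_iff₀ (by positivity) hpos]
    have : 0 < r * S := by positivity
    nlinarith
  have hm : ∀ m : ℕ, -4 * K * (2 * m + 1) ≤ (Complex.tanh (Real.pi * ((2 * (m : ℂ) + 1) *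
      Complex.exp (θ * Complex.I)) / 2)).im := by
    intro m
    have hw := odd_mul_re_pos m hre
    have hpos := Complex.normSq_pos.2 (one_add_exp_ne_zero hw)
    have hnorm := norm_exp_sub_one_le (Real.pi * ((2 * (m : ℂ) + 1) *
      Complex.exp (θ * Complex.I)) / 2)
    have hrm : Real.exp (2 * (Real.pi * ((2 * (m : ℂ) + 1) *
        Complex.exp (θ * Complex.I)) / 2).re) = r ^ (2 * m + 1) := by
      rw [odd_mul_re, Complex.exp_ofReal_mul_I_re, hrdef, ← Real.exp_nat_mul]
      congr 1
      push_cast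
      ring
    rw [hrm] at hnorm
    have hrn : 0 < r ^ (2 * m + 1) - 1 := by
      have := one_lt_pow₀ hr (by omega : 2 * m + 1 ≠ 0)
      linarith
    have hsq : (r ^ (2 * m + 1) - 1) ^ 2 ≤ Complex.normSq (1 + Complex.exp (2 * (Real.pi *
        ((2 * (m : ℂ) + 1) * Complex.exp (θ * Complex.I)) / 2))) := by
      rw [Complex.normSq_eq_norm_sq]
      gcongr
    rw [tanh_im hw, him, le_div_iff₀ hpos]
    have hsin' := abs_sin_nat_mul_le (2 * m + 1) (Real.pi * Real.sin θ)
    rw [← hSdef, abs_of_pos hS] at hsin'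
    have h2 := neg_abs_le (Real.sin ((2 * m + 1 : ℕ) * (Real.pi * Real.sin θ)))
    have h3 : -((2 * m + 1 : ℕ) * S) ≤ Real.sin ((2 * m + 1 : ℕ) * (Real.pi * Real.sin θ)) := by
      linarith
    -- This compares `r^n / (r^n - 1)²` with `r / (r - 1)²`; the factor `n` in the bound comes from
    -- `|sin nx| ≤ n |sin x|`.
    have h4 := pow_mul_sub_one_sq_le hr (2 * m)
    have hR : 0 < r ^ (2 * m + 1) := by positivity
    generalize Complex.normSq (1 + Complex.exp (2 * (Real.pi *
        ((2 * (m : ℂ) + 1) * Complex.exp (θ * Complex.I)) / 2))) = D at *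
    generalize Real.sin ((2 * m + 1 : ℕ) * (Real.pi * Real.sin θ)) = s at *
    generalize r ^ (2 * m + 1) = R at *
    push_cast at h3
    have h5 : R * S ≤ 2 * K * D := by
      have : R * S = R * (r - 1) ^ 2 * (S / (r - 1) ^ 2) := by
        field_simp
      rw [this]
      have hK2 : 2 * K = r * (S / (r - 1) ^ 2) := by
        rw [hK]
        field_simp
      rw [hK2]
      have : 0 < S / (r - 1) ^ 2 := by positivity
      have h6 : r * (R - 1) ^ 2 ≤ r * D := by gcongr
      nlinarith
    have h7 : R * -((2 * m + 1) * S) ≤ R * s := by gcongr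
    have h8 : (2 * (m : ℝ) + 1) * (R * S) ≤ (2 * m + 1) * (2 * K * D) := by gcongr
    linarith
  -- The comparison series uses `-4K / n^(2N)` throughout; the extra `5K` at index `0` turns `-4K`
  -- into `K`.
  have hsum := (((summable_odd_pow (s := 2 * N) (by omega)).hasSum.mul_left (-4 * K)).add
    (hasSum_ite_eq (0 : ℕ) (5 * K)))
  have hle := hasSum_le (fun m => ?_) hsum (hasSum_tanhSeries_im hN hre)
  · refine lt_of_lt_of_le ?_ hle
    have h2 := oddZeta_le_oddZeta_two (s := 2 * N) (by omega)
    have h3 := oddZeta_two_lt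
    rw [oddZeta] at h2
    nlinarith
  · rcases Nat.eq_zero_or_pos m with rfl | hmpos
    · simpa using (by linarith : -(4 * K) + 5 * K ≤ K).trans (by simpa using hzero)
    · rw [if_neg hmpos.ne', add_zero]
      have h2 : (0 : ℝ) < 2 * m + 1 := by positivity
      calc -4 * K * (1 / (2 * (m : ℝ) + 1) ^ (2 * N)) =
          -4 * K * (2 * m + 1) * (1 / (2 * (m : ℝ) + 1) ^ (2 * N + 1)) := by
            rw [pow_succ]
            field_simp
        _ ≤ _ := by
            have := hm m
            gcongr

/-! ### Roots from the intermediate value theorem for the phase. -/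

/-- The slit plane makes `arg` continuous and excludes `arg = π`, so conjugation negates it and the
phase is odd. Its range then contains `[-b, b]`. -/
theorem exists_phase_eq {a b c : ℝ} (ha : 0 ≤ a) (N : ℕ) {G : ℝ → ℂ}
    (hcont : ContinuousOn G (Set.Icc (-a) a)) (hslit : ∀ θ ∈ Set.Icc (-a) a, G θ ∈ Complex.slitPlane)
    (hconj : ∀ θ, G (-θ) = (starRingEnd ℂ) (G θ)) (hend : b ≤ N * a + (G a).arg) (hc : |c| ≤ b) :
    ∃ θ ∈ Set.Icc (-a) a, N * θ + (G θ).arg = c := by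
  have hcont' : ContinuousOn (fun θ : ℝ => N * θ + (G θ).arg) (Set.Icc (-a) a) := by
    refine (by fun_prop : ContinuousOn (fun θ : ℝ => N * θ) _).add fun θ hθ => ?_
    exact (Complex.continuousAt_arg (hslit θ hθ)).comp_continuousWithinAt (hcont θ hθ)
  have hne : (G a).arg ≠ Real.pi :=
    (Complex.mem_slitPlane_iff_arg.1 (hslit a ⟨by linarith, le_rfl⟩)).1
  refine intermediate_value_Icc (by linarith) hcont' ⟨?_, ?_⟩
  · rw [hconj, Complex.arg_conj, if_neg hne]
    linarith [neg_abs_le c]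
  · exact (le_abs_self c).trans (hc.trans hend)

/-- `oddZeta (2N+1) - σ * tanhSeries N (exp (-θ I))`. -/
noncomputable def phaseFun (N : ℕ) (σ θ : ℝ) : ℂ :=
  oddZeta (2 * N + 1) - σ * tanhSeries N (Complex.exp ((-θ : ℝ) * Complex.I))

theorem exp_neg_mul_I_eq_conj (θ : ℝ) : Complex.exp ((-θ : ℝ) * Complex.I) =
    (starRingEnd ℂ) (Complex.exp (θ * Complex.I)) := by
  rw [← Complex.exp_conj]
  simp

theorem phaseFun_neg (N : ℕ) (σ θ : ℝ) :
    phaseFun N σ (-θ) = (starRingEnd ℂ) (phaseFun N σ θ) := by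
  rw [phaseFun, phaseFun, exp_neg_mul_I_eq_conj, tanhSeries_conj]
  have := exp_neg_mul_I_eq_conj θ
  rw [this, tanhSeries_conj]
  simp

theorem continuousOn_phaseFun {N : ℕ} (hN : 1 ≤ N) (σ : ℝ) {a : ℝ} (ha : a < Real.pi / 2) :
    ContinuousOn (phaseFun N σ) (Set.Icc (-a) a) := by
  rcases lt_or_ge a 0 with h | h
  · rw [Set.Icc_eq_empty (by linarith)]
    exact continuousOn_empty _
  have hcos : 0 < Real.cos a := Real.cos_pos_of_mem_Ioo ⟨by linarith [Real.pi_pos], ha⟩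
  refine continuousOn_const.sub (continuousOn_const.mul
    ((continuousOn_tanhSeries hN hcos).comp (by fun_prop) fun θ hθ => ?_))
  rw [Set.mem_ofPred_eq, Complex.exp_ofReal_mul_I_re, Real.cos_neg, ← Real.cos_abs θ]
  exact Real.cos_le_cos_of_nonneg_of_le_pi (abs_nonneg θ) (by linarith [Real.pi_pos])
    (abs_le.2 hθ)

theorem eval_reducedQ {N : ℕ} (hN : 1 ≤ N) {σ : ℝ} (hσ : σ ^ 2 = 1) {z : ℂ} (hz : ‖z‖ = 1)
    (hre : 0 < z.re) :
    (reducedQ N).eval (σ * z) = (-1) ^ (N + 1) * (oddZeta (2 * N + 1) - σ * tanhSeries N z) +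
      z ^ (2 * N) * (oddZeta (2 * N + 1) - σ * tanhSeries N z⁻¹) := by
  have h := sum_oddZeta_eq_tanhSeries hN hz hre
  have hσ' : (σ : ℂ) ^ 2 = 1 := by exact_mod_cast hσ
  have hterm : ∀ i ∈ Finset.range N, (-1) ^ (N + i) * (oddZeta (2 * (i + 1)) : ℂ) *
      (oddZeta (2 * (N - i)) : ℂ) * (σ * z) ^ (2 * i + 1) =
      σ * ((-1) ^ (N + i) * (oddZeta (2 * (i + 1)) : ℂ) *
      (oddZeta (2 * (N - i)) : ℂ) * z ^ (2 * i + 1)) := by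
    intro i _
    rw [mul_pow, pow_succ (σ : ℂ), pow_mul (σ : ℂ), hσ', one_pow]
    ring
  simp only [reducedQ, eval_add, eval_mul, eval_C, eval_finsetSum, eval_pow, eval_X]
  rw [Finset.sum_congr rfl hterm, ← Finset.mul_sum, mul_pow (σ : ℂ) z, pow_mul (σ : ℂ), hσ', one_pow]
  linear_combination (σ : ℂ) * h

theorem eval_reducedQ_eq_zero {N : ℕ} (hN : 1 ≤ N) {σ : ℝ} (hσ : σ ^ 2 = 1) {θ : ℝ}
    (hcos : 0 < Real.cos θ) {j : ℤ}
    (h : N * θ + (phaseFun N σ θ).arg = (N - 2 * j) * (Real.pi / 2)) :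
    (reducedQ N).eval (σ * Complex.exp (θ * Complex.I)) = 0 := by
  have hinv : (Complex.exp (θ * Complex.I))⁻¹ = Complex.exp ((-θ : ℝ) * Complex.I) := by
    rw [← Complex.exp_neg]
    congr 1
    push_cast
    ring
  have hG : (oddZeta (2 * N + 1) : ℂ) - σ * tanhSeries N (Complex.exp (θ * Complex.I)) =
      phaseFun N σ (-θ) := by
    rw [phaseFun, neg_neg]
  rw [eval_reducedQ hN hσ (Complex.norm_exp_ofReal_mul_I θ)
    (by rwa [Complex.exp_ofReal_mul_I_re]), hinv, hG, phaseFun_neg, ← phaseFun]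
  set α := (phaseFun N σ θ).arg with hα
  have hpolar := Complex.norm_mul_exp_arg_mul_I (phaseFun N σ θ)
  rw [← hα] at hpolar
  rw [← hpolar, map_mul, Complex.conj_ofReal, ← exp_neg_mul_I_eq_conj, ← Complex.exp_nat_mul]
  -- Twice the phase condition, exponentiated: `2Nθ + 2α = Nπ - 2πj`.
  have hexp : Complex.exp ((2 * N : ℕ) * (θ * Complex.I)) * Complex.exp (α * Complex.I) =
      (-1) ^ N * Complex.exp ((-α : ℝ) * Complex.I) := by
    rw [← Complex.exp_pi_mul_I, ← Complex.exp_nat_mul, ← Complex.exp_add, ← Complex.exp_add,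
      Complex.exp_eq_exp_iff_exists_int]
    refine ⟨-j, ?_⟩
    have h' : (N : ℂ) * θ + α = (N - 2 * j) * (Real.pi / 2) := by exact_mod_cast h
    push_cast
    linear_combination (2 * Complex.I) * h'
  linear_combination (‖phaseFun N σ θ‖ : ℂ) * hexp

theorem exists_finset_roots {N : ℕ} (hN : 1 ≤ N) {σ : ℝ} (hσ : σ ^ 2 = 1) {a b : ℝ} (ha : 0 ≤ a)
    (ha' : a < Real.pi / 2)
    (hslit : ∀ θ ∈ Set.Icc (-a) a, phaseFun N σ θ ∈ Complex.slitPlane)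
    (hend : b ≤ N * a + (phaseFun N σ a).arg) (n : ℕ) (e : ℤ)
    (hn : ∀ j < n, |((N : ℝ) - 2 * ((j + e : ℤ) : ℝ)) * (Real.pi / 2)| ≤ b) :
    ∃ S : Finset ℂ, S.card = n ∧
      ∀ w ∈ S, (reducedQ N).eval w = 0 ∧ ‖w‖ = 1 ∧ 0 < σ * w.re := by
  have hex : ∀ j : ℕ, ∃ θ : ℝ, j < n → θ ∈ Set.Icc (-a) a ∧
      N * θ + (phaseFun N σ θ).arg = ((N : ℝ) - 2 * ((j + e : ℤ) : ℝ)) * (Real.pi / 2) := by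
    intro j
    by_cases hj : j < n
    · obtain ⟨θ, h1, h2⟩ := exists_phase_eq ha N (continuousOn_phaseFun hN σ ha') hslit
        (phaseFun_neg N σ) hend (hn j hj)
      exact ⟨θ, fun _ => ⟨h1, h2⟩⟩
    · exact ⟨0, fun h => absurd h hj⟩
  choose t ht using hex
  have hcos : ∀ j < n, 0 < Real.cos (t j) := fun j hj =>
    Real.cos_pos_of_mem_Ioo ⟨by linarith [(ht j hj).1.1], by linarith [(ht j hj).1.2]⟩
  have hσ0 : (σ : ℂ) ≠ 0 := by
    rintro h
    rw [Complex.ofReal_eq_zero.1 h] at hσ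
    norm_num at hσ
  refine ⟨(Finset.range n).image fun j => σ * Complex.exp (t j * Complex.I), ?_, ?_⟩
  · rw [Finset.card_image_of_injOn, Finset.card_range]
    intro i hi j hj hij
    have hi' : i < n := by simpa using hi
    have hj' : j < n := by simpa using hj
    have hexp := mul_left_cancel₀ hσ0 hij
    have hteq : t i = t j := by
      have := congrArg Complex.arg hexp
      rwa [Complex.arg_exp_mul_I, Complex.arg_exp_mul_I, toIocMod_eq_self Real.two_pi_pos |>.2,
        toIocMod_eq_self Real.two_pi_pos |>.2] at this
      · exact ⟨by linarith [(ht j hj').1.1], by linarith [(ht j hj').1.2]⟩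
      · exact ⟨by linarith [(ht i hi').1.1], by linarith [(ht i hi').1.2]⟩
    -- Equal angles have equal phases, and the prescribed phases differ for different indices.
    have h1 := (ht i hi').2
    rw [hteq, (ht j hj').2] at h1
    have h2 := mul_right_cancel₀ (by positivity) h1
    push_cast at h2
    have h3 : (i : ℝ) = j := by linarith
    exact_mod_cast h3
  · intro w hw
    obtain ⟨j, hj, rfl⟩ := Finset.mem_image.1 hw
    have hj' := Finset.mem_range.1 hj
    refine ⟨eval_reducedQ_eq_zero hN hσ (hcos j hj') (ht j hj').2, ?_, ?_⟩
    · rw [norm_mul, Complex.norm_exp_ofReal_mul_I, mul_one, Complex.norm_real, Real.norm_eq_abs,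
        ← sq_eq_sq₀ (abs_nonneg σ) zero_le_one, sq_abs, hσ, one_pow]
    · rw [Complex.re_ofReal_mul, Complex.exp_ofReal_mul_I_re, ← mul_assoc, ← sq, hσ, one_mul]
      exact hcos j hj'

theorem phaseFun_eq_conj (N : ℕ) (σ θ : ℝ) : phaseFun N σ θ =
    (starRingEnd ℂ) (oddZeta (2 * N + 1) - σ * tanhSeries N (Complex.exp (θ * Complex.I))) := by
  rw [phaseFun, exp_neg_mul_I_eq_conj, tanhSeries_conj]
  simp

theorem phaseFun_re (N : ℕ) (σ θ : ℝ) : (phaseFun N σ θ).re =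
    oddZeta (2 * N + 1) - σ * (tanhSeries N (Complex.exp (θ * Complex.I))).re := by
  rw [phaseFun_eq_conj]
  simp

theorem phaseFun_im (N : ℕ) (σ θ : ℝ) : (phaseFun N σ θ).im =
    σ * (tanhSeries N (Complex.exp (θ * Complex.I))).im := by
  rw [phaseFun_eq_conj]
  simp

theorem exists_finset_roots_left {N : ℕ} (hN : 1 ≤ N) : ∃ S : Finset ℂ, S.card = N - 1 ∧
    ∀ w ∈ S, (reducedQ N).eval w = 0 ∧ ‖w‖ = 1 ∧ w.re < 0 := by
  have hp := Real.pi_pos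
  have hN' : (1 : ℝ) ≤ N := by exact_mod_cast hN
  have hdiv : Real.pi / (2 * N) ≤ Real.pi / 2 := by
    gcongr
    linarith
  have hdiv' : 0 < Real.pi / (2 * N) := by positivity
  have hre : ∀ θ : ℝ, 0 < Real.cos θ → 0 < (phaseFun N (-1) θ).re := by
    intro θ hθ
    rw [phaseFun_re]
    have := tanhSeries_re_nonneg hN (z := Complex.exp (θ * Complex.I))
      (by rwa [Complex.exp_ofReal_mul_I_re])
    have := one_le_oddZeta (s := 2 * N + 1) (by omega)
    linarith
  have hcos : ∀ θ ∈ Set.Icc (-(Real.pi / 2 - Real.pi / (2 * N))) (Real.pi / 2 - Real.pi / (2 * N)),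
      0 < Real.cos θ := fun θ hθ =>
    Real.cos_pos_of_mem_Ioo ⟨by linarith [hθ.1], by linarith [hθ.2]⟩
  -- Here `N a = (N - 1) π/2` and `arg G > -π/2`. For `N = 1` the bound is negative and no root is
  -- claimed.
  have hend : ((N : ℝ) - 2) * (Real.pi / 2) ≤ N * (Real.pi / 2 - Real.pi / (2 * N)) +
      (phaseFun N (-1) (Real.pi / 2 - Real.pi / (2 * N))).arg := by
    have h := Complex.abs_arg_lt_pi_div_two_iff.2
      (Or.inl (hre _ (hcos _ ⟨by linarith, le_rfl⟩)))
    have h2 : N * (Real.pi / (2 * N)) = Real.pi / 2 := by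
      field_simp
    rw [mul_sub, h2]
    linarith [neg_abs_le (phaseFun N (-1) (Real.pi / 2 - Real.pi / (2 * N))).arg]
  have hn : ∀ j < N - 1, |((N : ℝ) - 2 * (((j : ℤ) + 1 : ℤ) : ℝ)) * (Real.pi / 2)| ≤
      (N - 2) * (Real.pi / 2) := by
    intro j hj
    rw [abs_mul, abs_of_pos (by positivity : 0 < Real.pi / 2)]
    have : (j : ℝ) + 2 ≤ N := by exact_mod_cast (by omega : j + 2 ≤ N)
    have hj0 : (0 : ℝ) ≤ j := j.cast_nonneg
    gcongr
    rw [abs_le]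
    push_cast
    constructor <;> linarith
  obtain ⟨S, hS, hroots⟩ := exists_finset_roots hN (σ := -1) (by norm_num)
    (a := Real.pi / 2 - Real.pi / (2 * N)) (b := (N - 2) * (Real.pi / 2)) (by linarith)
    (by linarith) (fun θ hθ => Or.inl (hre θ (hcos θ hθ))) hend
    (N - 1) 1 hn
  exact ⟨S, hS, fun w hw => ⟨(hroots w hw).1, (hroots w hw).2.1, by linarith [(hroots w hw).2.2]⟩⟩

theorem phaseFun_one_mem_slitPlane {N : ℕ} (hN : 1 ≤ N) {θ : ℝ} (h1 : -(Real.pi / 2) < θ)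
    (h2 : θ < Real.pi / 2) : phaseFun N 1 θ ∈ Complex.slitPlane := by
  rw [Complex.mem_slitPlane_iff]
  rcases lt_trichotomy θ 0 with h | rfl | h
  · right
    rw [← neg_neg θ, phaseFun_neg, Complex.conj_im, phaseFun_im]
    have := tanhSeries_im_pos hN (θ := -θ) (by linarith) (by linarith)
    simpa using this.ne'
  · left
    rw [phaseFun_re]
    have := tanhSeries_one_re_lt hN
    simpa using this
  · right
    rw [phaseFun_im]
    simpa using (tanhSeries_im_pos hN h h2).ne'

theorem exists_finset_roots_right {N : ℕ} (hN : 1 ≤ N) : ∃ S : Finset ℂ, S.card = N + 1 ∧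
    ∀ w ∈ S, (reducedQ N).eval w = 0 ∧ ‖w‖ = 1 ∧ 0 < w.re := by
  have hp := Real.pi_gt_three
  have hp4 := Real.pi_lt_d2
  have hN' : (1 : ℝ) ≤ N := by exact_mod_cast hN
  have hdiv : 1 / (10 * (N : ℝ)) ≤ 1 / 10 := by
    gcongr
    linarith
  have hdiv' : 0 < 1 / (10 * (N : ℝ)) := by positivity
  -- The offset gives `cos a ≤ 1/10`, hence `exp (π cos a) ≤ 3/2`, and costs the phase `N a` only
  -- `1/10`, well below the `π/2` gained from `arg G`.
  set a := Real.pi / 2 - 1 / (10 * (N : ℝ)) with ha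
  have hcos : 0 < Real.cos a := Real.cos_pos_of_mem_Ioo ⟨by linarith, by linarith⟩
  have hsin : 0 < Real.sin a := Real.sin_pos_of_pos_of_lt_pi (by linarith) (by linarith)
  have hcos' : Real.cos a ≤ 1 / 10 := by
    rw [ha, Real.cos_pi_div_two_sub]
    exact (Real.sin_le hdiv'.le).trans hdiv
  have hexp : Real.exp (Real.pi * Real.cos a) ≤ 3 / 2 := by
    have hx : Real.pi * Real.cos a ≤ 1 / 3 := by nlinarith
    have := Real.exp_bound_div_one_sub_of_interval (by positivity : 0 ≤ Real.pi * Real.cos a)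
      (by linarith)
    refine this.trans ?_
    rw [div_le_iff₀ (by linarith)]
    linarith
  have hend : (N : ℝ) * (Real.pi / 2) ≤ N * a + (phaseFun N 1 a).arg := by
    have hre : (phaseFun N 1 a).re < 0 := by
      rw [phaseFun_re]
      have h1 := five_div_four_le_re_tanhSeries hN hsin.le hcos hexp
      have h2 := oddZeta_le_oddZeta_two (s := 2 * N + 1) (by omega)
      linarith [oddZeta_two_lt]
    have him : 0 ≤ (phaseFun N 1 a).im := by
      rw [phaseFun_im]
      linarith [tanhSeries_im_pos hN (θ := a) (by linarith) (by linarith)]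
    have harg0 := Complex.arg_nonneg_iff.2 him
    have harg : Real.pi / 2 < (phaseFun N 1 a).arg := by
      by_contra hle
      have := Complex.abs_arg_le_pi_div_two_iff.1
        ((abs_of_nonneg harg0).trans_le (not_lt.1 hle))
      linarith
    have h2 : N * (1 / (10 * (N : ℝ))) = 1 / 10 := by
      field_simp
    rw [ha, mul_sub, h2, ← ha]
    linarith
  have hn : ∀ j < N + 1, |((N : ℝ) - 2 * (((j : ℤ) + 0 : ℤ) : ℝ)) * (Real.pi / 2)| ≤
      N * (Real.pi / 2) := by
    intro j hj
    rw [abs_mul, abs_of_pos (by positivity : 0 < Real.pi / 2)]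
    have : (j : ℝ) ≤ N := by exact_mod_cast (by omega : j ≤ N)
    have hj0 : (0 : ℝ) ≤ j := j.cast_nonneg
    gcongr
    rw [abs_le]
    push_cast
    constructor <;> linarith
  obtain ⟨S, hS, hroots⟩ := exists_finset_roots hN (σ := 1) (by norm_num)
    (a := a) (b := N * (Real.pi / 2)) (by linarith)
    (by linarith) (fun θ hθ => phaseFun_one_mem_slitPlane hN (by linarith [hθ.1])
      (by linarith [hθ.2])) hend (N + 1) 0 hn
  exact ⟨S, hS, fun w hw => ⟨(hroots w hw).1, (hroots w hw).2.1, by linarith [(hroots w hw).2.2]⟩⟩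

/-! ### Counting the roots. -/

theorem polyQ_ne_zero {N : ℕ} (hN : 1 ≤ N) : polyQ (N + 1) ≠ 0 := by
  rw [polyQ_eq_reducedQ hN]
  refine mul_ne_zero (mul_ne_zero (C_ne_zero.2 (pow_ne_zero _ two_ne_zero)) X_ne_zero) ?_
  intro h
  exact reducedQ_eval_zero_ne_zero hN (by rw [h, eval_zero])

theorem exists_finset_roots_polyQ {N : ℕ} (hN : 1 ≤ N) : ∃ S : Finset ℂ,
    (polyQ (N + 1)).roots = S.val ∧ ∀ w ∈ S, w = 0 ∨ ‖w‖ = 1 := by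
  obtain ⟨R, hRcard, hR⟩ := exists_finset_roots_right hN
  obtain ⟨T, hTcard, hT⟩ := exists_finset_roots_left hN
  have hdisj : Disjoint R T := Finset.disjoint_left.2 fun w hw hw' => by
    linarith [(hR w hw).2.2, (hT w hw').2.2]
  have h0 : (0 : ℂ) ∉ R ∪ T := by
    intro h
    rcases Finset.mem_union.1 h with h | h
    · simpa using (hR 0 h).2.1
    · simpa using (hT 0 h).2.1
  have hne := polyQ_ne_zero hN
  have hdeg : (polyQ (N + 1)).natDegree ≤ 2 * N + 1 := by
    rw [polyQ_eq_reducedQ hN, mul_assoc]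
    refine (natDegree_C_mul_le _ _).trans (natDegree_mul_le.trans ?_)
    rw [natDegree_X]
    linarith [natDegree_reducedQ_le N]
  have heval : ∀ w, (reducedQ N).eval w = 0 → (polyQ (N + 1)).IsRoot w := by
    intro w hw
    rw [IsRoot, polyQ_eq_reducedQ hN, eval_mul, hw, mul_zero]
  -- The set has `1 + (N + 1) + (N - 1) = 2N + 1` elements, the degree bound; equality as multisets
  -- carries the simplicity.
  refine ⟨insert 0 (R ∪ T), (Multiset.eq_of_le_of_card_le ?_ ?_).symm, ?_⟩
  · rw [Multiset.le_iff_subset (Finset.nodup _)]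
    intro w hw
    rw [mem_roots hne]
    rcases Finset.mem_insert.1 hw with rfl | hw
    · rw [IsRoot, polyQ_eq_reducedQ hN]
      simp
    · rcases Finset.mem_union.1 hw with hw | hw
      · exact heval w (hR w hw).1
      · exact heval w (hT w hw).1
  · refine ((card_roots' _).trans hdeg).trans ?_
    rw [Finset.card_val, Finset.card_insert_of_notMem h0, Finset.card_union_of_disjoint hdisj,
      hRcard, hTcard]
    omega
  · intro w hw
    rcases Finset.mem_insert.1 hw with rfl | hw
    · exact Or.inl rfl
    · rcases Finset.mem_union.1 hw with hw | hw
      · exact Or.inr (hR w hw).2.1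
      · exact Or.inr (hT w hw).2.1

theorem theorem4 (k : ℕ) (hk : 2 ≤ k) :
    polyQ k =
        C ((2 * (Real.pi : ℂ)) ^ (2 * k - 1) / ((2 * k).factorial : ℂ)) *
            ∑ j ∈ Finset.range (k + 1),
              C ((-1) ^ j * (_root_.bernoulli (2 * j) : ℂ) * (_root_.bernoulli (2 * k - 2 * j) : ℂ) *
                ((2 : ℂ) ^ (2 * j) - 1) * ((2 : ℂ) ^ (2 * k - 2 * j) - 1) *
                ((2 * k).choose (2 * j) : ℂ)) * X ^ (2 * j) +
          C (riemannZeta (2 * (k : ℂ) - 1) * ((2 : ℂ) ^ (2 * k - 1) - 1)) *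
            (C ((-1) ^ k) * X + X ^ (2 * k - 1)) ∧
      (∀ z : ℂ, (polyQ k).IsRoot z → z ≠ 0 → ‖z‖ = 1) ∧
      (∀ z : ℂ, (polyQ k).IsRoot z → (polyQ k).rootMultiplicity z = 1) := by
  obtain ⟨N, rfl⟩ : ∃ N, k = N + 1 := ⟨k - 1, by omega⟩
  obtain ⟨S, hS, hroots⟩ := exists_finset_roots_polyQ (N := N) (by omega)
  have hne := polyQ_ne_zero (N := N) (by omega)
  have hmem : ∀ z, (polyQ (N + 1)).IsRoot z → z ∈ S := by
    intro z hz
    have := (mem_roots hne).2 hz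
    rwa [hS] at this
  refine ⟨polyQ_eq _ hk, fun z hz hz0 => (hroots z (hmem z hz)).resolve_left hz0, fun z hz => ?_⟩
  rw [← count_roots, hS]
  exact Multiset.count_eq_one_of_mem S.nodup (hmem z hz)
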